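/- Let $\alpha>0$, $\delta>0$ and let $s\ge 2$ be an integer. For every integer $k\ge 1$ put $n=k(s+1)-1$, let $X_1,\dots,X_n$ be independent random variables with the Pareto$(\alpha,\delta)$ distribution, i.e. with distribution function $F(x)=1-(\delta/x)^{\alpha}$ for $x>\delta$ and $F(x)=0$ for $x\le\delta$, and let $X_{(1,n)}\le\dots\le X_{(n,n)}$ be their increasing order statistics. Let $H_m=\sum_{j=1}^m \frac1j$ (with $H_0=0$) and $$L_{k,s}=\log\frac{X_{(ks,n)}}{X_{(k,n)}},\qquad Q_{k,s}=\frac{L_{k,s}}{H_{ks-1}-H_{k-1}},\qquad Q^*_{k,s}=\frac{L_{k,s}}{\log s}.$$ Then, in distribution as $k\to\infty$, $$\sqrt{n}\left[L_{k,s}-\frac{\log s}{\alpha}\right]\to N\!\left(0,\frac{s^2-1}{s\alpha^2}\right),$$ $$\sqrt{n}\,(H_{ks-1}-H_{k-1})\left[\alpha Q_{k,s}-\frac{\log s}{H_{ks-1}-H_{k-1}}\right]\to N\!\left(0,\frac{s^2-1}{s}\right),$$ $$\sqrt{n}\left[\alpha Q^*_{k,s}-1\right]\to N\!\left(0,\frac{s^2-1}{s(\log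 s)^2}\right).$$ Consequently, for every $\alpha_0\in(0,1)$, with $z_{1-\alpha_0/2}$ the $(1-\alpha_0/2)$-quantile of the standard normal distribution, $$P\left[\frac{\log s}{L_{k,s}}-\frac{z_{1-\alpha_0/2}}{L_{k,s}}\sqrt{\frac{s^2-1}{sn}}\le\alpha\le\frac{\log s}{L_{k,s}}+\frac{z_{1-\alpha_0/2}}{L_{k,s}}\sqrt{\frac{s^2-1}{sn}}\right]\to 1-\alpha_0\qquad(k\to\infty).$$ -/

import Mathlib

noncomputable section

namespace ParetoOrder

/-- The `i`-th smallest value `x_(i,n)` of `x₁, …, xₙ`, for `1 ≤ i ≤ n` (the value for other `i` is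
a dummy `0`). -/
def orderStat {n : ℕ} (x : Fin n → ℝ) (i : ℕ) : ℝ :=
  if h : 1 ≤ i ∧ i ≤ n then x (Tuple.sort x ⟨i - 1, by omega⟩) else 0

/-- `log (x_(ks,n) / x_(k,n))` for a sample of size `n = k(s+1) - 1`. -/
def logRatio (k s : ℕ) (x : Fin (k * (s + 1) - 1) → ℝ) : ℝ :=
  Real.log (orderStat x (k * s) / orderStat x k)

/-- `H_{ks-1} - H_{k-1}`, a difference of harmonic numbers. -/
def harmonicDiff (k s : ℕ) : ℝ := (harmonic (k * s - 1) : ℝ) - (harmonic (k - 1) : ℝ)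

/-- The statistic `Q_{k,s}`. -/
def Q (k s : ℕ) (x : Fin (k * (s + 1) - 1) → ℝ) : ℝ := logRatio k s x / harmonicDiff k s

/-- The statistic `Q*_{k,s}`. -/
def QStar (k s : ℕ) (x : Fin (k * (s + 1) - 1) → ℝ) : ℝ := logRatio k s x / Real.log s

/-- The `p`-quantile of the standard normal distribution. -/
def normalQuantile (p : ℝ) : ℝ :=
  sInf {z : ℝ | p ≤ ProbabilityTheory.cdf (ProbabilityTheory.gaussianReal 0 1) z}

/-- The confidence interval for the shape parameter at level `1 - a`, computed from a sample `x`. -/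
def confInterval (k s : ℕ) (a : ℝ) (x : Fin (k * (s + 1) - 1) → ℝ) : Set ℝ :=
  Set.Icc
    (Real.log s / logRatio k s x - normalQuantile (1 - a / 2) / logRatio k s x *
      √(((s : ℝ) ^ 2 - 1) / (s * (k * (s + 1) - 1))))
    (Real.log s / logRatio k s x + normalQuantile (1 - a / 2) / logRatio k s x *
      √(((s : ℝ) ^ 2 - 1) / (s * (k * (s + 1) - 1))))

end ParetoOrder

end

/-!
If `X` has the Pareto law then `log (X / δ)` is exponential of rate `α`, so that `logRatio` is a
difference of two order statistics of an exponential sample. Memorylessness turns such a sample,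
once its minimum is subtracted, into an exponential sample with one entry less, independent of that
minimum. By induction (Rényi), `logRatio k s` has the characteristic function of a sum of
independent exponential variables of rates `j * α`, `k ≤ j < k * s`. Hence `α * logRatio k s` has
mean `harmonicDiff k s = log s + O(1 / k)`, and its variance, the sum of the `1 / j ^ 2`, is
asymptotic to `(s ^ 2 - 1) / (s * n)`. Expanding `log (1 - z)⁻¹` to second order gives the normal
limit by Lévy's continuity theorem, and the confidence interval covers `α` exactly when the
standardized `logRatio` has absolute value at most the quantile.
-/

namespace ParetoOrder

open Complex Function MeasureTheory ProbabilityTheory Filter Topology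
open scoped ENNReal

section OrderStat

variable {n : ℕ}

lemma orderStat_eq_of_monotone {x : Fin n → ℝ} {σ : Equiv.Perm (Fin n)} (hσ : Monotone (x ∘ σ))
    {i : ℕ} (hi : 1 ≤ i ∧ i ≤ n) : orderStat x i = x (σ ⟨i - 1, by omega⟩) := by
  have := congrFun (Tuple.comp_sort_eq_comp_iff_monotone.2 hσ) ⟨i - 1, by omega⟩
  simpa [orderStat, hi] using this.symm

@[simp]
lemma orderStat_zero (x : Fin n → ℝ) : orderStat x 0 = 0 := by simp [orderStat]

lemma orderStat_comp_perm (x : Fin n → ℝ) (σ : Equiv.Perm (Fin n)) (i : ℕ) :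
    orderStat (x ∘ σ) i = orderStat x i := by
  unfold orderStat
  split_ifs
  · exact congrFun Tuple.comp_perm_comp_sort_eq_comp_sort _
  · rfl

lemma orderStat_mem_range (x : Fin n → ℝ) {i : ℕ} (hi : 1 ≤ i ∧ i ≤ n) :
    orderStat x i ∈ Set.range x := by
  simp [orderStat, hi]

lemma orderStat_comp_of_monotoneOn {x : Fin n → ℝ} {g : ℝ → ℝ} (hg : MonotoneOn g (Set.range x))
    {i : ℕ} (hi : 1 ≤ i ∧ i ≤ n) : orderStat (g ∘ x) i = g (orderStat x i) := by
  have hsort : Monotone ((g ∘ x) ∘ Tuple.sort x) := fun a b hab =>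
    hg ⟨_, rfl⟩ ⟨_, rfl⟩ (Tuple.monotone_sort x hab)
  rw [orderStat_eq_of_monotone hsort hi]
  simp [orderStat, hi]

lemma orderStat_le_orderStat (x : Fin n → ℝ) {i j : ℕ} (hi : 1 ≤ i) (hij : i ≤ j) (hj : j ≤ n) :
    orderStat x i ≤ orderStat x j := by
  simp only [orderStat, hi, hij.trans hj, hi.trans hij, hj, and_self, dite_true]
  exact Tuple.monotone_sort x (by simp only [Fin.mk_le_mk]; omega)

lemma monotone_cons_comp_decomposeFin_symm {v : ℝ} {y : Fin n → ℝ} (hv : ∀ j, v ≤ y j)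
    {σ : Equiv.Perm (Fin n)} (hσ : Monotone (y ∘ σ)) :
    Monotone ((Fin.cons v y : Fin (n + 1) → ℝ) ∘ Equiv.Perm.decomposeFin.symm (0, σ)) := by
  intro a b hab
  cases a using Fin.cases with
  | zero => cases b using Fin.cases <;> simp [hv]
  | succ a =>
    cases b using Fin.cases with
    | zero => simp at hab
    | succ b => simpa using hσ (Fin.succ_le_succ_iff.1 hab)

lemma orderStat_cons_one {v : ℝ} {y : Fin n → ℝ} (hv : ∀ j, v ≤ y j) :
    orderStat (Fin.cons v y : Fin (n + 1) → ℝ) 1 = v := by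
  rw [orderStat_eq_of_monotone
    (monotone_cons_comp_decomposeFin_symm hv (Tuple.monotone_sort y)) (by omega)]
  simp

lemma orderStat_cons_succ {v : ℝ} {y : Fin n → ℝ} (hv : ∀ j, v ≤ y j) {i : ℕ}
    (hi : 1 ≤ i ∧ i ≤ n) :
    orderStat (Fin.cons v y : Fin (n + 1) → ℝ) (i + 1) = orderStat y i := by
  have hsucc : (⟨i + 1 - 1, by omega⟩ : Fin (n + 1)) = Fin.succ ⟨i - 1, by omega⟩ :=
    Fin.ext (by simp; omega)
  rw [orderStat_eq_of_monotone
    (monotone_cons_comp_decomposeFin_symm hv (Tuple.monotone_sort y)) (by omega), hsucc]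
  simp [orderStat, hi, -Fin.succ_mk]

-- For `i = 0` this relies on the dummy value `orderStat y 0 = 0`.
lemma orderStat_cons_const_add (v : ℝ) {y : Fin n → ℝ} (hy : ∀ j, 0 ≤ y j) {i : ℕ} (hi : i ≤ n) :
    orderStat (Fin.cons v fun j => v + y j : Fin (n + 1) → ℝ) (i + 1) = v + orderStat y i := by
  have hv (j : Fin n) : v ≤ v + y j := le_add_of_nonneg_right (hy j)
  rcases Nat.eq_zero_or_pos i with rfl | hpos
  · simp [orderStat_cons_one hv]
  · rw [orderStat_cons_succ hv ⟨hpos, hi⟩]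
    exact orderStat_comp_of_monotoneOn (g := (v + ·))
      (fun a _ b _ hab => add_le_add_right hab v) ⟨hpos, hi⟩

@[fun_prop]
lemma measurable_orderStat (i : ℕ) : Measurable fun x : Fin n → ℝ => orderStat x i := by
  by_cases hi : 1 ≤ i ∧ i ≤ n
  · refine measurable_of_Iic fun t => ?_
    have hpre : (fun x : Fin n → ℝ => orderStat x i) ⁻¹' Set.Iic t = ⋃ σ : Equiv.Perm (Fin n),
        {x | Monotone (x ∘ σ)} ∩ {x | x (σ ⟨i - 1, by omega⟩) ≤ t} := by
      ext x
      simp only [Set.mem_preimage, Set.mem_Iic, Set.mem_iUnion, Set.mem_inter_iff,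
        Set.mem_ofPred_eq]
      constructor
      · intro hx
        exact ⟨Tuple.sort x, Tuple.monotone_sort x, by simpa [orderStat, hi] using hx⟩
      · rintro ⟨σ, hσ, hx⟩
        rwa [orderStat_eq_of_monotone hσ hi]
    rw [hpre]
    refine MeasurableSet.iUnion fun σ => MeasurableSet.inter ?_
      (measurableSet_le (by fun_prop) (by fun_prop))
    simp only [Monotone, Set.ofPred_forall, comp_apply]
    exact MeasurableSet.iInter fun a => MeasurableSet.iInter fun b => MeasurableSet.iInter fun _ =>
      measurableSet_le (by fun_prop) (by fun_prop)
  · simp [orderStat, hi]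

end OrderStat

section Minimum

variable {n : ℕ} {E : Type*}

/-- The samples in which the `i`-th entry is minimal. Samples with ties lie in several of these
sets. -/
def argminSet [LE E] (i : Fin (n + 1)) : Set (Fin (n + 1) → E) := {x | ∀ j, x i ≤ x j}

lemma iUnion_argminSet [LinearOrder E] : ⋃ i, (argminSet i : Set (Fin (n + 1) → E)) = Set.univ :=
  Set.eq_univ_of_forall fun x => Set.mem_iUnion.2 (Finite.exists_min x)

lemma insertNth_mem_argminSet [Preorder E] (i : Fin (n + 1)) (v : E) (y : Fin n → E) :
    (i.insertNth v y : Fin (n + 1) → E) ∈ argminSet i ↔ y ∈ Set.univ.pi fun _ => Set.Ici v := by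
  simp [argminSet, Fin.forall_iff_succAbove i, -Set.pi_univ_Ici]

variable [MeasurableSpace E]

lemma measure_pi_apply_eq_apply [MeasurableEq E] (μ : Measure E) [SigmaFinite μ]
    [NullSingletonClass μ] {i j : Fin (n + 1)} (hij : i ≠ j) :
    Measure.pi (fun _ => μ) {x | x i = x j} = 0 := by
  obtain ⟨j, rfl⟩ := Fin.exists_succAbove_eq hij.symm
  have hmeas : MeasurableSet {x : Fin (n + 1) → E | x i = x (i.succAbove j)} :=
    measurableSet_eq_fun (by fun_prop) (by fun_prop)
  have hsplit := (measurePreserving_piFinSuccAbove (fun _ => μ) i).symm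
  rw [← hsplit.measure_preimage hmeas.nullMeasurableSet,
    Measure.measure_prod_null (hsplit.measurable hmeas)]
  refine ae_of_all _ fun v => ?_
  convert! Measure.pi_hyperplane (fun _ : Fin n => μ) j v using 2
  ext y
  simp [MeasurableEquiv.piFinSuccAbove_symm_apply, eq_comm]

variable [LinearOrder E] [TopologicalSpace E] [OrderClosedTopology E] [SecondCountableTopology E]
  [OpensMeasurableSpace E]

lemma measurableSet_argminSet (i : Fin (n + 1)) :
    MeasurableSet (argminSet i : Set (Fin (n + 1) → E)) := by
  simp only [argminSet, Set.ofPred_forall]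
  exact MeasurableSet.iInter fun j => measurableSet_le (by fun_prop) (by fun_prop)

lemma pairwise_aedisjoint_argminSet (μ : Measure E) [SigmaFinite μ] [NullSingletonClass μ] :
    Pairwise (AEDisjoint (Measure.pi fun _ : Fin (n + 1) => μ) on argminSet) := fun i j hij =>
  measure_mono_null (fun _ hx => (hx.1 j).antisymm (hx.2 i)) (measure_pi_apply_eq_apply μ hij)

lemma setLIntegral_argminSet (μ : Measure E) [SigmaFinite μ] {F : (Fin (n + 1) → E) → ℝ≥0∞}
    (hF : Measurable F) (hsymm : ∀ x (σ : Equiv.Perm (Fin (n + 1))), F (x ∘ σ) = F x)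
    (i : Fin (n + 1)) :
    ∫⁻ x in argminSet i, F x ∂Measure.pi (fun _ => μ) =
      ∫⁻ v, ∫⁻ y in Set.univ.pi (fun _ => Set.Ici v), F (Fin.cons v y)
        ∂Measure.pi (fun _ : Fin n => μ) ∂μ := by
  have hG : Measurable ((argminSet i).indicator F) := hF.indicator (measurableSet_argminSet i)
  rw [← lintegral_indicator (measurableSet_argminSet i),
    ← (measurePreserving_piFinSuccAbove (fun _ => μ) i).symm.lintegral_comp hG,
    lintegral_prod _ (by fun_prop)]
  refine lintegral_congr fun v => ?_
  rw [← lintegral_indicator (MeasurableSet.univ_pi fun _ => measurableSet_Ici)]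
  refine lintegral_congr fun y => ?_
  have hperm : F (i.insertNth v y) = F (Fin.cons v y) := by
    rw [← Fin.insertNth_comp_cycleRange_symm i, hsymm]
  change (argminSet i).indicator F (i.insertNth v y) = _
  classical
  simp only [Set.indicator_apply, insertNth_mem_argminSet, hperm]

lemma lintegral_pi_eq_lintegral_cons (μ : Measure E) [SigmaFinite μ] [NullSingletonClass μ]
    {F : (Fin (n + 1) → E) → ℝ≥0∞} (hF : Measurable F)
    (hsymm : ∀ x (σ : Equiv.Perm (Fin (n + 1))), F (x ∘ σ) = F x) :
    ∫⁻ x, F x ∂Measure.pi (fun _ => μ) = (n + 1) *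
      ∫⁻ v, ∫⁻ y in Set.univ.pi (fun _ => Set.Ici v), F (Fin.cons v y)
        ∂Measure.pi (fun _ : Fin n => μ) ∂μ := by
  rw [← setLIntegral_univ, ← iUnion_argminSet,
    lintegral_iUnion₀ (fun i => (measurableSet_argminSet i).nullMeasurableSet)
      (pairwise_aedisjoint_argminSet μ), tsum_fintype,
    Finset.sum_congr rfl fun i _ => setLIntegral_argminSet μ hF hsymm i]
  simp

end Minimum

section Exponential

variable {r : ℝ}

lemma expMeasure_eq_withDensity (r : ℝ) :
    expMeasure r = volume.withDensity (exponentialPDF r) := rfl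

@[fun_prop]
lemma measurable_exponentialPDF (r : ℝ) : Measurable (exponentialPDF r) :=
  (measurable_exponentialPDFReal r).ennreal_ofReal

instance nullSingletonClass_expMeasure (r : ℝ) : NullSingletonClass (expMeasure r) := by
  rw [expMeasure_eq_withDensity]
  infer_instance

lemma ae_nonneg_expMeasure (r : ℝ) : ∀ᵐ x ∂expMeasure r, 0 ≤ x := by
  rw [expMeasure_eq_withDensity, ae_withDensity_iff (by fun_prop)]
  exact ae_of_all _ fun x hx => not_lt.1 fun hneg => hx (exponentialPDF_of_neg hneg)

lemma exponentialPDF_add {u v : ℝ} (hu : 0 ≤ u) (hv : 0 ≤ v) :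
    exponentialPDF r (v + u) = ENNReal.ofReal (Real.exp (-(r * v))) * exponentialPDF r u := by
  rw [exponentialPDF_of_nonneg (add_nonneg hv hu), exponentialPDF_of_nonneg hu,
    ← ENNReal.ofReal_mul (Real.exp_nonneg _), mul_left_comm, ← Real.exp_add]
  ring_nf

lemma restrict_Ici_expMeasure (r : ℝ) {v : ℝ} (hv : 0 ≤ v) :
    (expMeasure r).restrict (Set.Ici v) =
      ENNReal.ofReal (Real.exp (-(r * v))) • (expMeasure r).map (v + ·) := by
  ext s hs
  rw [Measure.restrict_apply hs, Measure.smul_apply, Measure.map_apply (by fun_prop) hs,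
    expMeasure_eq_withDensity, withDensity_apply _ (hs.inter measurableSet_Ici),
    withDensity_apply _ (hs.preimage (by fun_prop)), smul_eq_mul,
    ← lintegral_const_mul _ (by fun_prop), ← lintegral_indicator (hs.inter measurableSet_Ici),
    ← lintegral_indicator (hs.preimage (by fun_prop)), ← lintegral_add_left_eq_self _ v]
  refine lintegral_congr fun u => ?_
  classical
  rcases le_or_gt 0 u with hu | hu
  · simp [Set.indicator_apply, hu, exponentialPDF_add hu hv]
  · simp [Set.indicator_apply, hu.not_ge, exponentialPDF_of_neg hu]

lemma restrict_pi_Ici_expMeasure {ι : Type*} [Fintype ι] (hr : 0 < r) {v : ℝ} (hv : 0 ≤ v) :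
    (Measure.pi fun _ : ι => expMeasure r).restrict (Set.univ.pi fun _ => Set.Ici v) =
      ENNReal.ofReal (Real.exp (-(r * v))) ^ Fintype.card ι •
        (Measure.pi fun _ : ι => expMeasure r).map (fun y j => v + y j) := by
  have := isProbabilityMeasure_expMeasure hr
  have (_ : ι) : IsProbabilityMeasure ((expMeasure r).map (v + ·)) :=
    Measure.isProbabilityMeasure_map (by fun_prop)
  rw [Measure.restrict_pi_pi, Measure.pi_map_pi fun _ => by fun_prop]
  refine Measure.pi_eq fun s _ => ?_
  simp [restrict_Ici_expMeasure r hv, Finset.prod_mul_distrib]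

lemma natCast_add_one_mul_exponentialPDF (n : ℕ) (v : ℝ) (hr : 0 ≤ r) :
    ((n : ℝ≥0∞) + 1) * (exponentialPDF r v * ENNReal.ofReal (Real.exp (-(r * v))) ^ n) =
      exponentialPDF ((n + 1) * r) v := by
  rcases le_or_gt 0 v with hv | hv
  · have hn : (n : ℝ≥0∞) + 1 = ENNReal.ofReal (n + 1) := by
      rw [ENNReal.ofReal_add (by positivity) zero_le_one]
      simp
    rw [exponentialPDF_of_nonneg hv, exponentialPDF_of_nonneg hv, hn,
      ← ENNReal.ofReal_pow (by positivity), ← ENNReal.ofReal_mul (by positivity),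
      ← ENNReal.ofReal_mul (by positivity), ← Real.exp_nat_mul, mul_assoc, ← Real.exp_add]
    ring_nf
  · simp [exponentialPDF_of_neg hv]

lemma lintegral_expMeasure (r : ℝ) {f : ℝ → ℝ≥0∞} (hf : Measurable f) :
    ∫⁻ x, f x ∂expMeasure r = ∫⁻ x, exponentialPDF r x * f x := by
  rw [expMeasure_eq_withDensity, lintegral_withDensity_eq_lintegral_mul _ (by fun_prop) hf]
  rfl

-- The sample minus its minimum is independent of the minimum: this is memorylessness.
lemma lintegral_pi_expMeasure_succ (hr : 0 < r) {n : ℕ} {F : (Fin (n + 1) → ℝ) → ℝ≥0∞}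
    (hF : Measurable F) (hsymm : ∀ x (σ : Equiv.Perm (Fin (n + 1))), F (x ∘ σ) = F x) :
    ∫⁻ x, F x ∂Measure.pi (fun _ => expMeasure r) =
      ∫⁻ p, F (Fin.cons p.1 fun j => p.1 + p.2 j)
        ∂(expMeasure ((n + 1) * r)).prod (Measure.pi fun _ : Fin n => expMeasure r) := by
  have := isProbabilityMeasure_expMeasure hr
  have hFcons : Measurable fun p : ℝ × (Fin n → ℝ) => F (Fin.cons p.1 fun j => p.1 + p.2 j) := by
    fun_prop
  have hexceed : ∀ᵐ v ∂expMeasure r, ∫⁻ y in Set.univ.pi (fun _ => Set.Ici v), F (Fin.cons v y)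
        ∂Measure.pi (fun _ : Fin n => expMeasure r) =
      ENNReal.ofReal (Real.exp (-(r * v))) ^ n * ∫⁻ y, F (Fin.cons v fun j => v + y j)
        ∂Measure.pi (fun _ : Fin n => expMeasure r) := by
    filter_upwards [ae_nonneg_expMeasure r] with v hv
    rw [restrict_pi_Ici_expMeasure hr hv, lintegral_smul_measure,
      lintegral_map (by fun_prop) (by fun_prop), smul_eq_mul, Fintype.card_fin]
  have := hFcons.lintegral_prod_right' (ν := Measure.pi fun _ : Fin n => expMeasure r)
  rw [lintegral_pi_eq_lintegral_cons _ hF hsymm, lintegral_congr_ae hexceed,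
    lintegral_prod _ (by fun_prop), lintegral_expMeasure _ (by fun_prop),
    lintegral_expMeasure _ (by fun_prop), ← lintegral_const_mul _ (by fun_prop)]
  refine lintegral_congr fun v => ?_
  rw [← natCast_add_one_mul_exponentialPDF n v hr.le]
  ring

lemma map_pi_expMeasure_succ (hr : 0 < r) {n : ℕ} {β : Type*} [MeasurableSpace β]
    {T : (Fin (n + 1) → ℝ) → β} (hT : Measurable T)
    (hsymm : ∀ x (σ : Equiv.Perm (Fin (n + 1))), T (x ∘ σ) = T x) :
    (Measure.pi fun _ => expMeasure r).map T =
      ((expMeasure ((n + 1) * r)).prod (Measure.pi fun _ : Fin n => expMeasure r)).map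
        fun p => T (Fin.cons p.1 fun j => p.1 + p.2 j) := by
  refine Measure.ext_of_lintegral _ fun f hf => ?_
  rw [lintegral_map hf hT, lintegral_map hf (by fun_prop)]
  exact lintegral_pi_expMeasure_succ hr (hf.comp hT) fun x σ => by simp only [hsymm]

end Exponential

section Renyi

variable {r : ℝ}

lemma charFun_expMeasure (hr : 0 < r) (t : ℝ) :
    charFun (expMeasure r) t = (1 - (t / r : ℝ) * I)⁻¹ := by
  have hre : (t * I - r : ℂ).re < 0 := by simpa using hr
  have hdensity (x : ℝ) : (exponentialPDF r x).toReal • Complex.exp (t * x * I) =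
      (Set.Ici 0).indicator (fun x : ℝ => (r : ℂ) * Complex.exp ((t * I - r) * x)) x := by
    rcases le_or_gt 0 x with hx | hx
    · rw [Set.indicator_of_mem (by simpa using hx), exponentialPDF_of_nonneg hx,
        ENNReal.toReal_ofReal (by positivity), Complex.real_smul]
      push_cast
      rw [mul_assoc, ← Complex.exp_add]
      ring_nf
    · simp [hx.not_ge, exponentialPDF_of_neg hx]
  rw [charFun_apply_real, expMeasure_eq_withDensity,
    integral_withDensity_eq_integral_toReal_smul (measurable_exponentialPDF r)
      (ae_of_all _ fun x => (ENNReal.ofReal_lt_top : exponentialPDF r x < ⊤)),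
    integral_congr_ae (ae_of_all _ hdensity), integral_indicator measurableSet_Ici,
    integral_Ici_eq_integral_Ioi, integral_const_mul, integral_exp_mul_complex_Ioi hre]
  have hr' : (r : ℂ) ≠ 0 := by exact_mod_cast hr.ne'
  have hfac : 1 - ((t / r : ℝ) : ℂ) * I = -(t * I - r) / r := by
    push_cast
    field_simp
    ring
  rw [hfac, inv_div, Complex.ofReal_zero, mul_zero, Complex.exp_zero, neg_div, mul_neg,
    mul_one_div, div_neg]

lemma ae_forall_nonneg_pi_expMeasure {ι : Type*} [Fintype ι] (hr : 0 < r) :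
    ∀ᵐ y ∂Measure.pi fun _ : ι => expMeasure r, ∀ j, 0 ≤ y j := by
  have := isProbabilityMeasure_expMeasure hr
  exact eventually_all.2 fun j =>
    (Measure.tendsto_eval_ae_ae (i := j)).eventually (ae_nonneg_expMeasure r)

lemma map_orderStat_succ (hr : 0 < r) {n i : ℕ} (hi : i ≤ n) :
    (Measure.pi fun _ : Fin (n + 1) => expMeasure r).map (fun x => orderStat x (i + 1)) =
      expMeasure ((n + 1) * r) ∗
        (Measure.pi fun _ : Fin n => expMeasure r).map (fun y => orderStat y i) := by
  have := isProbabilityMeasure_expMeasure hr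
  have := isProbabilityMeasure_expMeasure (by positivity : 0 < (n + 1) * r)
  have hsplit : (fun p : ℝ × (Fin n → ℝ) =>
        orderStat (Fin.cons p.1 fun j => p.1 + p.2 j : Fin (n + 1) → ℝ) (i + 1))
      =ᵐ[(expMeasure ((n + 1) * r)).prod (Measure.pi fun _ => expMeasure r)]
        fun p => p.1 + orderStat p.2 i := by
    filter_upwards [Measure.quasiMeasurePreserving_snd.ae (ae_forall_nonneg_pi_expMeasure hr)]
      with p hp using orderStat_cons_const_add p.1 hp hi
  have hprod := Measure.map_prod_map (expMeasure ((n + 1) * r))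
    (Measure.pi fun _ : Fin n => expMeasure r) measurable_id (measurable_orderStat i)
  rw [Measure.map_id] at hprod
  rw [map_pi_expMeasure_succ hr (measurable_orderStat _) fun x σ => orderStat_comp_perm x σ _,
    Measure.map_congr hsplit, Measure.conv, hprod, Measure.map_map (by fun_prop) (by fun_prop)]
  rfl

lemma map_orderStat_sub_orderStat_succ (hr : 0 < r) {n a b : ℕ} (ha : a ≤ n) (hb : b ≤ n) :
    (Measure.pi fun _ : Fin (n + 1) => expMeasure r).map
        (fun x => orderStat x (b + 1) - orderStat x (a + 1)) =
      (Measure.pi fun _ : Fin n => expMeasure r).map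
        (fun y => orderStat y b - orderStat y a) := by
  have := isProbabilityMeasure_expMeasure hr
  have := isProbabilityMeasure_expMeasure (by positivity : 0 < (n + 1) * r)
  have hsplit : (fun p : ℝ × (Fin n → ℝ) =>
        orderStat (Fin.cons p.1 fun j => p.1 + p.2 j : Fin (n + 1) → ℝ) (b + 1) -
          orderStat (Fin.cons p.1 fun j => p.1 + p.2 j : Fin (n + 1) → ℝ) (a + 1))
      =ᵐ[(expMeasure ((n + 1) * r)).prod (Measure.pi fun _ => expMeasure r)]
        (fun y => orderStat y b - orderStat y a) ∘ Prod.snd := by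
    filter_upwards [Measure.quasiMeasurePreserving_snd.ae (ae_forall_nonneg_pi_expMeasure hr)]
      with p hp
    rw [orderStat_cons_const_add p.1 hp hb, orderStat_cons_const_add p.1 hp ha,
      add_sub_add_left_eq_sub, comp_apply]
  rw [map_pi_expMeasure_succ hr (by fun_prop) fun x σ => by simp only [orderStat_comp_perm],
    Measure.map_congr hsplit, ← Measure.map_map (by fun_prop) (by fun_prop),
    measurePreserving_snd.map_eq]

lemma charFun_map_orderStat (hr : 0 < r) {n b : ℕ} (hb : b ≤ n) (t : ℝ) :
    charFun ((Measure.pi fun _ : Fin n => expMeasure r).map fun x => orderStat x b) t =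
      ∏ j ∈ Finset.Ioc (n - b) n, (1 - (t / (j * r) : ℝ) * I)⁻¹ := by
  have := isProbabilityMeasure_expMeasure hr
  induction b generalizing n with
  | zero => simp [charFun_dirac]
  | succ b ih =>
    obtain ⟨n, rfl⟩ := Nat.exists_eq_add_of_le' (Nat.one_le_of_lt hb)
    have hbn : b ≤ n := Nat.le_of_succ_le_succ hb
    have hrate : 0 < (n + 1) * r := by positivity
    have := isProbabilityMeasure_expMeasure hrate
    rw [map_orderStat_succ hr hbn, charFun_conv, ih hbn, charFun_expMeasure hrate,
      Nat.add_sub_add_right, Finset.prod_Ioc_succ_top (Nat.sub_le n b), mul_comm, Nat.cast_succ]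

-- Rényi's representation: the difference is distributed as a sum of independent exponential
-- variables of rates `j * r`.
lemma charFun_map_orderStat_sub_orderStat (hr : 0 < r) {n a b : ℕ} (hab : a ≤ b) (hb : b ≤ n)
    (t : ℝ) :
    charFun ((Measure.pi fun _ : Fin n => expMeasure r).map
        fun x => orderStat x b - orderStat x a) t =
      ∏ j ∈ Finset.Ioc (n - b) (n - a), (1 - (t / (j * r) : ℝ) * I)⁻¹ := by
  induction a generalizing b n with
  | zero => simpa using charFun_map_orderStat hr hb t
  | succ a ih =>
    obtain ⟨b, rfl⟩ := Nat.exists_eq_add_of_le' (Nat.one_le_of_lt hab)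
    obtain ⟨n, rfl⟩ := Nat.exists_eq_add_of_le' (Nat.one_le_of_lt hb)
    rw [map_orderStat_sub_orderStat_succ hr (by omega) (by omega), ih (by omega) (by omega),
      Nat.add_sub_add_right, Nat.add_sub_add_right]

end Renyi

section LogExpansion

lemma norm_log_one_sub_inv_sub_le {z : ℂ} (hz : ‖z‖ ≤ 1 / 2) :
    ‖Complex.log (1 - z)⁻¹ - (z + z ^ 2 / 2)‖ ≤ ‖z‖ ^ 3 := by
  have htaylor : Complex.logTaylor 3 (-z) = -(z + z ^ 2 / 2) := by
    simp [Complex.logTaylor, Finset.sum_range_succ]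
    ring
  have hrem := Complex.norm_log_one_sub_inv_add_logTaylor_neg_le 2 (z := z) (by linarith)
  norm_num only [htaylor, ← sub_eq_add_neg] at hrem
  have hinv : (1 - ‖z‖)⁻¹ ≤ 2 := by
    rw [inv_le_comm₀ (by linarith) two_pos]
    linarith
  calc _ ≤ _ := hrem
    _ ≤ ‖z‖ ^ 3 * 2 / 3 := by gcongr
    _ ≤ ‖z‖ ^ 3 := by linarith [pow_nonneg (norm_nonneg z) 3]

variable {ι κ : Type*} {l : Filter ι} {S : ι → Finset κ} {x : ι → κ → ℝ} {ε : ι → ℝ} {v : ℝ}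

lemma tendsto_sum_log_one_sub_mul_I_inv_sub (hε : Tendsto ε l (𝓝 0))
    (hx : ∀ᶠ i in l, ∀ j ∈ S i, |x i j| ≤ ε i)
    (hv : Tendsto (fun i => ∑ j ∈ S i, x i j ^ 2) l (𝓝 v)) :
    Tendsto (fun i => ∑ j ∈ S i,
      (Complex.log (1 - x i j * I)⁻¹ - (x i j * I + (x i j * I) ^ 2 / 2))) l (𝓝 0) := by
  refine squeeze_zero_norm' ?_ (by simpa using hε.mul hv)
  filter_upwards [hx, hε.eventually_le_const one_half_pos] with i hxi hεi
  rw [Finset.mul_sum]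
  refine norm_sum_le_of_le _ fun j hj => ?_
  have hnorm : ‖(x i j * I : ℂ)‖ = |x i j| := by simp
  calc ‖Complex.log (1 - x i j * I)⁻¹ - (x i j * I + (x i j * I) ^ 2 / 2)‖
      ≤ |x i j| ^ 3 := hnorm ▸ norm_log_one_sub_inv_sub_le (hnorm ▸ (hxi j hj).trans hεi)
    _ = |x i j| * x i j ^ 2 := by rw [← sq_abs (x i j)]; ring
    _ ≤ ε i * x i j ^ 2 := by gcongr; exact hxi j hj

-- Lyapunov's theorem for sums of independent exponential variables with means `x i j`, in terms of
-- their characteristic functions.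
lemma tendsto_exp_mul_prod_one_sub_mul_I_inv {c : ι → ℝ} {m : ℝ} (hε : Tendsto ε l (𝓝 0))
    (hx : ∀ᶠ i in l, ∀ j ∈ S i, |x i j| ≤ ε i)
    (hm : Tendsto (fun i => ∑ j ∈ S i, x i j - c i) l (𝓝 m))
    (hv : Tendsto (fun i => ∑ j ∈ S i, x i j ^ 2) l (𝓝 v)) :
    Tendsto (fun i => Complex.exp (-(c i * I)) * ∏ j ∈ S i, (1 - x i j * I)⁻¹) l
      (𝓝 (Complex.exp (m * I - v / 2))) := by
  have hexponent := (((Complex.continuous_ofReal.tendsto m).comp hm).mul_const I).sub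
    (((Complex.continuous_ofReal.tendsto v).comp hv).div_const 2) |>.add
    (tendsto_sum_log_one_sub_mul_I_inv_sub hε hx hv)
  rw [add_zero] at hexponent
  refine ((Complex.continuous_exp.tendsto _).comp hexponent).congr fun i => ?_
  have hne (j : κ) : (1 - x i j * I : ℂ)⁻¹ ≠ 0 :=
    inv_ne_zero fun h => by simpa using congrArg Complex.re h
  rw [Finset.prod_congr rfl fun j _ => (Complex.exp_log (hne j)).symm, ← Complex.exp_sum,
    ← Complex.exp_add]
  simp only [comp_apply, Finset.sum_sub_distrib, Finset.sum_add_distrib, mul_pow, I_sq,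
    Complex.ofReal_sub, Complex.ofReal_sum, Complex.ofReal_pow, ← Finset.sum_mul,
    ← Finset.sum_div]
  ring_nf

end LogExpansion

section Sums

lemma sum_Ico_sub_integral_mem_Icc {f : ℝ → ℝ} {a b : ℕ} (hab : a ≤ b)
    (hf : AntitoneOn f (Set.Icc a b)) :
    ∑ j ∈ Finset.Ico a b, f j - ∫ x in a..b, f x ∈ Set.Icc 0 (f a - f b) := by
  have hlow := hf.integral_le_sum_Ico hab
  have hup := hf.sum_le_integral_Ico hab
  have htele := Finset.sum_Ico_sub (fun j : ℕ => f j) hab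
  rw [Finset.sum_sub_distrib] at htele
  constructor <;> linarith

lemma sum_Ico_inv_sub_log_mem_Icc {a b : ℕ} (ha : 0 < a) (hab : a ≤ b) :
    ∑ j ∈ Finset.Ico a b, (j : ℝ)⁻¹ - Real.log (b / a) ∈ Set.Icc 0 (a : ℝ)⁻¹ := by
  have hanti : AntitoneOn (fun x : ℝ => x⁻¹) (Set.Icc a b) :=
    inv_antitoneOn_Icc_right (by exact_mod_cast ha)
  rw [← integral_inv_of_pos (by exact_mod_cast ha) (by exact_mod_cast ha.trans_le hab)]
  exact Set.Icc_subset_Icc_right (by simp) (sum_Ico_sub_integral_mem_Icc hab hanti)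

lemma sum_Ico_inv_sq_sub_mem_Icc {a b : ℕ} (ha : 0 < a) (hab : a ≤ b) :
    ∑ j ∈ Finset.Ico a b, ((j : ℝ) ^ 2)⁻¹ - ((a : ℝ)⁻¹ - (b : ℝ)⁻¹) ∈
      Set.Icc 0 ((a : ℝ) ^ 2)⁻¹ := by
  have ha' : (0 : ℝ) < a := by exact_mod_cast ha
  have hab' : (a : ℝ) ≤ b := by exact_mod_cast hab
  have hanti : AntitoneOn (fun x : ℝ => (x ^ 2)⁻¹) (Set.Icc a b) := fun x hx y _ hxy =>
    inv_anti₀ (pow_pos (ha'.trans_le hx.1) 2) (pow_le_pow_left₀ (ha'.trans_le hx.1).le hxy 2)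
  have hint : ∫ x in (a : ℝ)..b, (x ^ 2)⁻¹ = (a : ℝ)⁻¹ - (b : ℝ)⁻¹ := by
    have h := integral_zpow (a := a) (b := b) (n := -2)
      (Or.inr ⟨by norm_num, Set.notMem_uIcc_of_lt ha' (ha'.trans_le hab')⟩)
    norm_num [zpow_neg] at h
    simpa [div_neg] using h
  rw [← hint]
  exact Set.Icc_subset_Icc_right (by simp) (sum_Ico_sub_integral_mem_Icc hab hanti)

lemma harmonic_sub_harmonic {a b : ℕ} (hab : a ≤ b) :
    harmonic b - harmonic a = ∑ j ∈ Finset.Ico a b, ((j + 1 : ℕ) : ℚ)⁻¹ := by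
  rw [harmonic, harmonic, Finset.sum_Ico_eq_sub _ hab]

lemma harmonicDiff_eq_sum {k s : ℕ} (hk : 1 ≤ k) (hs : 1 ≤ s) :
    harmonicDiff k s = ∑ j ∈ Finset.Ico k (k * s), (j : ℝ)⁻¹ := by
  have hks : k ≤ k * s := Nat.le_mul_of_pos_right k hs
  rw [harmonicDiff, ← Rat.cast_sub, harmonic_sub_harmonic (Nat.sub_le_sub_right hks 1),
    Finset.sum_Ico_add' (fun j : ℕ => (j : ℚ)⁻¹), Nat.sub_add_cancel hk,
    Nat.sub_add_cancel (hk.trans hks)]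
  push_cast
  rfl

lemma harmonicDiff_pos {k s : ℕ} (hk : 1 ≤ k) (hs : 2 ≤ s) : 0 < harmonicDiff k s := by
  rw [harmonicDiff_eq_sum hk (by omega)]
  refine Finset.sum_pos (fun j hj => ?_) (Finset.nonempty_Ico.2 ?_)
  · have := hk.trans (Finset.mem_Ico.1 hj).1
    positivity
  · exact lt_mul_of_one_lt_right hk hs

end Sums

section Limits

variable {s : ℕ}

lemma tendsto_sampleSize_div (s : ℕ) :
    Tendsto (fun k : ℕ => ((k : ℝ) * (s + 1) - 1) / k) atTop (𝓝 (s + 1)) := by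
  have hlim : Tendsto (fun k : ℕ => (s + 1 : ℝ) - 1 / (k : ℝ)) atTop (𝓝 (s + 1 - 0)) :=
    tendsto_const_nhds.sub tendsto_one_div_atTop_nhds_zero_nat
  rw [sub_zero] at hlim
  refine hlim.congr' ?_
  filter_upwards [eventually_ge_atTop 1] with k hk
  field_simp

lemma tendsto_sqrt_sampleSize_div (s : ℕ) :
    Tendsto (fun k : ℕ => √((k : ℝ) * (s + 1) - 1) / k) atTop (𝓝 0) := by
  have hlim := ((tendsto_sampleSize_div s).mul tendsto_one_div_atTop_nhds_zero_nat).sqrt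
  rw [mul_zero, Real.sqrt_zero] at hlim
  refine hlim.congr fun k => ?_
  rw [div_mul_div_comm, mul_one, Real.sqrt_div' _ (by positivity),
    Real.sqrt_mul_self (by positivity)]

lemma tendsto_sqrt_sampleSize (s : ℕ) :
    Tendsto (fun k : ℕ => √((k : ℝ) * (s + 1) - 1)) atTop atTop :=
  Real.tendsto_sqrt_atTop.comp <| tendsto_atTop_add_const_right _ _ <|
    tendsto_natCast_atTop_atTop.atTop_mul_const (by positivity)

lemma sampleSize_nonneg {k : ℕ} (hk : 1 ≤ k) (s : ℕ) : (0 : ℝ) ≤ k * (s + 1) - 1 := by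
  have hk' : (1 : ℝ) ≤ k := by exact_mod_cast hk
  nlinarith [(Nat.cast_nonneg s : (0 : ℝ) ≤ s)]

lemma tendsto_sqrt_mul_harmonicDiff_sub_log (hs : 1 ≤ s) :
    Tendsto (fun k : ℕ => √((k : ℝ) * (s + 1) - 1) * (harmonicDiff k s - Real.log s))
      atTop (𝓝 0) := by
  have hbound : ∀ᶠ k : ℕ in atTop, harmonicDiff k s - Real.log s ∈ Set.Icc 0 (k : ℝ)⁻¹ := by
    filter_upwards [eventually_ge_atTop 1] with k hk
    have := sum_Ico_inv_sub_log_mem_Icc hk (Nat.le_mul_of_pos_right k hs)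
    rwa [← harmonicDiff_eq_sum hk hs, Nat.cast_mul, mul_div_cancel_left₀ _ (by positivity)] at this
  refine squeeze_zero' ?_ ?_ (tendsto_sqrt_sampleSize_div s)
  · filter_upwards [hbound] with k hk using mul_nonneg (Real.sqrt_nonneg _) hk.1
  · filter_upwards [hbound] with k hk
    exact mul_le_mul_of_nonneg_left hk.2 (Real.sqrt_nonneg _)

lemma tendsto_sampleSize_mul_sum_inv_sq (hs : 1 ≤ s) :
    Tendsto (fun k : ℕ => ((k : ℝ) * (s + 1) - 1) * ∑ j ∈ Finset.Ico k (k * s), ((j : ℝ) ^ 2)⁻¹)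
      atTop (𝓝 (((s : ℝ) ^ 2 - 1) / s)) := by
  have hs0 : (s : ℝ) ≠ 0 := by positivity
  have hmain : Tendsto (fun k : ℕ => ((k : ℝ) * (s + 1) - 1) * ((k : ℝ)⁻¹ - ((k * s : ℕ) : ℝ)⁻¹))
      atTop (𝓝 (((s : ℝ) ^ 2 - 1) / s)) := by
    have hlim := (tendsto_sampleSize_div s).mul_const (1 - (s : ℝ)⁻¹)
    rw [show ((s : ℝ) + 1) * (1 - (s : ℝ)⁻¹) = ((s : ℝ) ^ 2 - 1) / s by field_simp; ring] at hlim
    refine hlim.congr fun k => ?_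
    rw [Nat.cast_mul, mul_inv]
    ring
  have herror : Tendsto (fun k : ℕ => ((k : ℝ) * (s + 1) - 1) *
      (∑ j ∈ Finset.Ico k (k * s), ((j : ℝ) ^ 2)⁻¹ - ((k : ℝ)⁻¹ - ((k * s : ℕ) : ℝ)⁻¹)))
      atTop (𝓝 0) := by
    have hlim := (tendsto_sampleSize_div s).mul tendsto_inv_atTop_nhds_zero_nat
    rw [mul_zero] at hlim
    refine squeeze_zero' ?_ ?_ hlim
    all_goals
      filter_upwards [eventually_ge_atTop 1] with k hk
      have hsum := sum_Ico_inv_sq_sub_mem_Icc hk (Nat.le_mul_of_pos_right k hs)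
    · exact mul_nonneg (sampleSize_nonneg hk s) hsum.1
    · refine (mul_le_mul_of_nonneg_left hsum.2 (sampleSize_nonneg hk s)).trans_eq ?_
      ring
  simpa [← mul_add] using hmain.add herror

end Limits

section Pareto

variable {α δ : ℝ}

lemma paretoMeasure_real_Ioi (hα : 0 < α) (hδ : 0 < δ) {y : ℝ} (hy : δ ≤ y) :
    (paretoMeasure δ α).real (Set.Ioi y) = (δ / y) ^ α := by
  have hy0 : 0 < y := hδ.trans_le hy
  have hpdf : Set.EqOn (paretoPDF δ α) (fun x => ENNReal.ofReal (α * δ ^ α * x ^ (-(α + 1))))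
      (Set.Ioi y) := fun x hx => paretoPDF_of_le (hy.trans (le_of_lt hx))
  have hnonneg : 0 ≤ᵐ[volume.restrict (Set.Ioi y)] fun x => α * δ ^ α * x ^ (-(α + 1)) := by
    filter_upwards [ae_restrict_mem measurableSet_Ioi] with x hx
    have : 0 < x := hy0.trans hx
    simp only [Pi.zero_apply]
    positivity
  rw [measureReal_def, paretoMeasure, withDensity_apply _ measurableSet_Ioi,
    setLIntegral_congr_fun measurableSet_Ioi hpdf,
    ← integral_eq_lintegral_of_nonneg_ae hnonneg (by fun_prop), integral_const_mul,
    integral_Ioi_rpow_of_lt (by linarith) hy0, neg_add_rev, neg_add_cancel_comm,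
    Real.div_rpow hδ.le hy0.le, Real.rpow_neg hy0.le]
  field_simp

lemma ae_le_paretoMeasure (δ α : ℝ) : ∀ᵐ x ∂paretoMeasure δ α, δ ≤ x := by
  have hmeas : Measurable (paretoPDF δ α) := (measurable_paretoPDFReal δ α).ennreal_ofReal
  rw [paretoMeasure, ae_withDensity_iff hmeas]
  refine ae_of_all _ fun x hx => ?_
  by_contra! hlt
  exact hx (paretoPDF_of_lt hlt)

lemma map_log_div_paretoMeasure (hα : 0 < α) (hδ : 0 < δ) :
    (paretoMeasure δ α).map (fun x => Real.log (x / δ)) = expMeasure α := by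
  have := isProbabilityMeasure_paretoMeasure hδ hα
  have := isProbabilityMeasure_expMeasure hα
  have hmeas : Measurable fun x => Real.log (x / δ) := by fun_prop
  have := Measure.isProbabilityMeasure_map (μ := paretoMeasure δ α) hmeas.aemeasurable
  refine Measure.eq_of_cdf _ _ (StieltjesFunction.ext fun t => ?_)
  rw [cdf_expMeasure_eq hα, cdf_eq_real, ← Set.compl_Ioi,
    probReal_compl_eq_one_sub measurableSet_Ioi, map_measureReal_apply hmeas measurableSet_Ioi]
  split_ifs with ht
  · have hpre : (fun x => Real.log (x / δ)) ⁻¹' Set.Ioi t =ᵐ[paretoMeasure δ α]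
        Set.Ioi (δ * Real.exp t) := by
      filter_upwards [ae_le_paretoMeasure δ α] with x hx
      have hxδ : 0 < x / δ := div_pos (hδ.trans_le hx) hδ
      exact propext ((Real.lt_log_iff_exp_lt hxδ).trans (lt_div_iff₀' hδ))
    rw [measureReal_congr hpre, paretoMeasure_real_Ioi hα hδ
      (le_mul_of_one_le_right hδ.le (Real.one_le_exp ht)), div_mul_cancel_left₀ hδ.ne',
      ← Real.exp_neg, ← Real.exp_mul, neg_mul, mul_comm]
  · have hpre : (fun x => Real.log (x / δ)) ⁻¹' Set.Ioi t =ᵐ[paretoMeasure δ α] Set.univ := by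
      filter_upwards [ae_le_paretoMeasure δ α] with x hx
      have hlog : 0 ≤ Real.log (x / δ) := Real.log_nonneg ((one_le_div hδ).2 hx)
      exact propext (iff_true_intro ((not_le.1 ht).trans_le hlog))
    rw [measureReal_congr hpre, probReal_univ, sub_self]

end Pareto

section Quantile

variable (μ : Measure ℝ) [IsProbabilityMeasure μ] [NullSingletonClass μ]

lemma continuous_cdf : Continuous (cdf μ) := by
  refine continuous_iff_continuousAt.2 fun x => ?_
  rw [(monotone_cdf μ).continuousAt_iff_leftLim_eq_rightLim, StieltjesFunction.rightLim_eq]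
  have hjump := (cdf μ).measure_singleton x
  rw [measure_cdf, measure_singleton, eq_comm, ENNReal.ofReal_eq_zero, sub_nonpos] at hjump
  exact le_antisymm ((monotone_cdf μ).leftLim_le le_rfl) hjump

lemma cdf_sInf_setOf_le_cdf {p : ℝ} (hp0 : 0 < p) (hp1 : p < 1) :
    cdf μ (sInf {z | p ≤ cdf μ z}) = p := by
  obtain ⟨y, hy⟩ : ∃ y, cdf μ y = p :=
    mem_range_of_exists_le_of_exists_ge (continuous_cdf μ)
      (((tendsto_cdf_atBot μ).eventually_le_const hp0).exists)
      (((tendsto_cdf_atTop μ).eventually_const_le hp1).exists)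
  obtain ⟨b, hb⟩ := ((tendsto_cdf_atBot μ).eventually_lt_const hp0).exists
  have hbdd : BddBelow {z | p ≤ cdf μ z} :=
    ⟨b, fun z hz => ((monotone_cdf μ).reflect_lt (hb.trans_le hz)).le⟩
  refine le_antisymm ?_ ?_
  · exact (monotone_cdf μ (csInf_le hbdd hy.ge)).trans_eq hy
  · exact (isClosed_le continuous_const (continuous_cdf μ)).csInf_mem ⟨y, hy.ge⟩ hbdd

variable {μ} in
lemma cdf_neg_of_map_neg_eq (hμ : μ.map Neg.neg = μ) (z : ℝ) :
    cdf μ (-z) = 1 - cdf μ z := by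
  rw [cdf_eq_real, cdf_eq_real, ← probReal_compl_eq_one_sub measurableSet_Iic, Set.compl_Iic,
    measureReal_congr Ioi_ae_eq_Ici]
  nth_rewrite 1 [← hμ]
  rw [map_measureReal_apply measurable_neg measurableSet_Iic, Set.neg_preimage, Set.neg_Iic,
    neg_neg]

variable {μ} in
lemma measureReal_Icc_eq_cdf_sub {a b : ℝ} (hab : a ≤ b) :
    μ.real (Set.Icc a b) = cdf μ b - cdf μ a := by
  rw [← measureReal_congr Ioc_ae_eq_Icc, ← Set.Iic_sdiff_Iic,
    measureReal_sdiff (Set.Iic_subset_Iic.2 hab) measurableSet_Iic, cdf_eq_real, cdf_eq_real]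

lemma gaussianReal_real_Icc_normalQuantile {a : ℝ} (ha0 : 0 < a) (ha1 : a < 1) :
    (gaussianReal 0 1).real
      (Set.Icc (-normalQuantile (1 - a / 2)) (normalQuantile (1 - a / 2))) = 1 - a := by
  have := nullSingletonClass_gaussianReal (μ := 0) one_ne_zero
  set z := normalQuantile (1 - a / 2)
  have hz : cdf (gaussianReal 0 1) z = 1 - a / 2 :=
    cdf_sInf_setOf_le_cdf _ (by linarith) (by linarith)
  have hneg : cdf (gaussianReal 0 1) (-z) = a / 2 := by
    rw [cdf_neg_of_map_neg_eq (by simpa using gaussianReal_map_neg (μ := 0) (v := 1)), hz]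
    ring
  have hle : -z ≤ z := ((monotone_cdf (gaussianReal 0 1)).reflect_lt (by linarith)).le
  rw [measureReal_Icc_eq_cdf_sub hle, hz, hneg]
  ring

end Quantile

section Sample

variable {α δ : ℝ} {n a b : ℕ}

lemma log_orderStat_div_orderStat {x : Fin n → ℝ} (hx : ∀ i, 0 < x i) (hδ : 0 < δ) (ha : 1 ≤ a)
    (hab : a ≤ b) (hb : b ≤ n) :
    Real.log (orderStat x b / orderStat x a) =
      orderStat (fun i => Real.log (x i / δ)) b - orderStat (fun i => Real.log (x i / δ)) a := by
  have hmono : MonotoneOn (fun y => Real.log (y / δ)) (Set.range x) := by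
    rintro _ ⟨i, rfl⟩ _ - hij
    exact Real.log_le_log (div_pos (hx i) hδ) (div_le_div_of_nonneg_right hij hδ.le)
  have hlog {i : ℕ} (hi : 1 ≤ i ∧ i ≤ n) : orderStat (fun j => Real.log (x j / δ)) i =
      Real.log (orderStat x i) - Real.log δ := by
    obtain ⟨j, hj⟩ := orderStat_mem_range x hi
    rw [← Real.log_div (hj ▸ (hx j).ne') hδ.ne']
    exact orderStat_comp_of_monotoneOn hmono hi
  obtain ⟨i, hi⟩ := orderStat_mem_range x ⟨ha, hab.trans hb⟩
  obtain ⟨j, hj⟩ := orderStat_mem_range x ⟨ha.trans hab, hb⟩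
  rw [hlog ⟨ha, hab.trans hb⟩, hlog ⟨ha.trans hab, hb⟩, sub_sub_sub_cancel_right,
    Real.log_div (hj ▸ (hx j).ne') (hi ▸ (hx i).ne')]

variable {Ω : Type*} [MeasurableSpace Ω] {P : Measure Ω} {X : Fin n → Ω → ℝ}

lemma ae_forall_pos_of_hasLaw_paretoMeasure {ι : Type*} [Countable ι] {X : ι → Ω → ℝ}
    (hδ : 0 < δ) (hlaw : ∀ i, HasLaw (X i) (paretoMeasure δ α) P) : ∀ᵐ ω ∂P, ∀ i, 0 < X i ω :=
  ae_all_iff.2 fun i => ((hlaw i).ae_iff (by fun_prop)).2 <|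
    (ae_le_paretoMeasure δ α).mono fun _ => hδ.trans_le

lemma charFun_map_log_orderStat_div (hα : 0 < α) (hδ : 0 < δ)
    (hlaw : ∀ i, HasLaw (X i) (paretoMeasure δ α) P) (hindep : iIndepFun X P)
    (ha : 1 ≤ a) (hab : a ≤ b) (hb : b ≤ n) (t : ℝ) :
    charFun (P.map fun ω => Real.log
        (orderStat (fun i => X i ω) b / orderStat (fun i => X i ω) a)) t =
      ∏ j ∈ Finset.Ioc (n - b) (n - a), (1 - (t / (j * α) : ℝ) * I)⁻¹ := by
  have hlog : HasLaw (fun x => Real.log (x / δ)) (expMeasure α) (paretoMeasure δ α) :=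
    ⟨by fun_prop, map_log_div_paretoMeasure hα hδ⟩
  have hsample : HasLaw (fun ω i => Real.log (X i ω / δ))
      (Measure.pi fun _ : Fin n => expMeasure α) P :=
    (hindep.comp (fun _ x => Real.log (x / δ)) fun _ => by fun_prop).hasLaw_pi
      fun i => hlog.comp (hlaw i)
  have hspacing : (fun ω => Real.log
      (orderStat (fun i => X i ω) b / orderStat (fun i => X i ω) a)) =ᵐ[P]
      (fun x => orderStat x b - orderStat x a) ∘ fun ω i => Real.log (X i ω / δ) := by
    filter_upwards [ae_forall_pos_of_hasLaw_paretoMeasure hδ hlaw] with ω hω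
    exact log_orderStat_div_orderStat hω hδ ha hab hb
  rw [Measure.map_congr hspacing, ← AEMeasurable.map_map_of_aemeasurable (by fun_prop)
    hsample.aemeasurable, hsample.map_eq, charFun_map_orderStat_sub_orderStat hα hab hb]

end Sample

section AsymptoticNormality

lemma charFun_map_const_mul_sub {Ω : Type*} [MeasurableSpace Ω] {P : Measure Ω} {Y : Ω → ℝ}
    (hY : AEMeasurable Y P) (a b t : ℝ) :
    charFun (P.map fun ω => a * Y ω - b) t =
      Complex.exp (-((t * b : ℝ) * I)) * charFun (P.map Y) (a * t) := by
  have hmap : P.map (fun ω => a * Y ω - b) = (P.map fun ω => a * Y ω).map (· + -b) := by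
    rw [AEMeasurable.map_map_of_aemeasurable (by fun_prop) (by fun_prop)]
    rfl
  rw [hmap, charFun_map_add_const, charFun_map_mul_comp hY, mul_comm]
  simp

lemma tendstoInDistribution_const_mul_gaussianReal {ι : Type*} {l : Filter ι} {Ω : ι → Type*}
    [∀ i, MeasurableSpace (Ω i)] {P : (i : ι) → Measure (Ω i)} [∀ i, IsProbabilityMeasure (P i)]
    {Y : (i : ι) → Ω i → ℝ} {m v : ℝ}
    (hY : TendstoInDistribution Y l id P (gaussianReal m v.toNNReal)) (c : ℝ) :
    TendstoInDistribution (fun i ω => c * Y i ω) l id P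
      (gaussianReal (c * m) (c ^ 2 * v).toNNReal) := by
  have hmap : (gaussianReal m v.toNNReal).map (c * ·) =
      gaussianReal (c * m) (c ^ 2 * v).toNNReal := by
    rw [gaussianReal_map_const_mul, Real.toNNReal_mul (sq_nonneg c),
      Real.toNNReal_of_nonneg (sq_nonneg c)]
  have hc := hY.continuous_comp (continuous_const_mul c)
  refine ⟨hc.forall_aemeasurable, aemeasurable_id, ?_⟩
  simpa only [← hmap, Measure.map_id, comp_def, id_eq] using hc.tendsto

variable {α δ : ℝ} {s : ℕ}

@[fun_prop]
lemma measurable_logRatio (k s : ℕ) : Measurable (logRatio k s) := by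
  unfold logRatio
  fun_prop

lemma logRatio_nonneg {k : ℕ} {x : Fin (k * (s + 1) - 1) → ℝ} (hs : 1 ≤ s) (hk : 1 ≤ k)
    (hx : ∀ i, 0 < x i) : 0 ≤ logRatio k s x := by
  have hks : k ≤ k * s := Nat.le_mul_of_pos_right k hs
  have hksn : k * s ≤ k * (s + 1) - 1 := by rw [Nat.mul_add_one]; omega
  obtain ⟨i, hi⟩ := orderStat_mem_range x ⟨hk, hks.trans hksn⟩
  exact Real.log_nonneg <| (one_le_div (hi ▸ hx i)).2 <| orderStat_le_orderStat x hk hks hksn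

lemma charFun_map_logRatio {Ω : Type*} [MeasurableSpace Ω] {P : Measure Ω} {k : ℕ}
    {X : Fin (k * (s + 1) - 1) → Ω → ℝ} (hα : 0 < α) (hδ : 0 < δ) (hs : 1 ≤ s) (hk : 1 ≤ k)
    (hlaw : ∀ i, HasLaw (X i) (paretoMeasure δ α) P) (hindep : iIndepFun X P) (t : ℝ) :
    charFun (P.map fun ω => logRatio k s (fun i => X i ω)) t =
      ∏ j ∈ Finset.Ico k (k * s), (1 - (t / (j * α) : ℝ) * I)⁻¹ := by
  have hks : k ≤ k * s := Nat.le_mul_of_pos_right k hs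
  have hsize : k * (s + 1) = k * s + k := Nat.mul_add_one k s
  have hindices : Finset.Ioc (k * (s + 1) - 1 - k * s) (k * (s + 1) - 1 - k) =
      Finset.Ico k (k * s) := by
    ext j
    simp only [Finset.mem_Ioc, Finset.mem_Ico]
    omega
  rw [← hindices]
  exact charFun_map_log_orderStat_div hα hδ hlaw hindep hk hks (by omega) t

variable {Ω : ℕ → Type*} [∀ k, MeasurableSpace (Ω k)] {P : (k : ℕ) → Measure (Ω k)}
  [∀ k, IsProbabilityMeasure (P k)] {X : (k : ℕ) → Fin (k * (s + 1) - 1) → Ω k → ℝ}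

lemma tendsto_charFun_standardized_logRatio (hs : 1 ≤ s) (t : ℝ) :
    Tendsto (fun k : ℕ => Complex.exp (-((t * (√((k : ℝ) * (s + 1) - 1) * Real.log s) : ℝ) * I)) *
        ∏ j ∈ Finset.Ico k (k * s), (1 - (t * √((k : ℝ) * (s + 1) - 1) / j : ℝ) * I)⁻¹)
      atTop (𝓝 (Complex.exp (-(((s : ℝ) ^ 2 - 1) / s * t ^ 2 / 2 : ℝ)))) := by
  have hε : Tendsto (fun k : ℕ => |t| * (√((k : ℝ) * (s + 1) - 1) / k)) atTop (𝓝 0) := by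
    simpa using (tendsto_sqrt_sampleSize_div s).const_mul |t|
  have hsmall : ∀ᶠ k : ℕ in atTop, ∀ j ∈ Finset.Ico k (k * s),
      |t * √((k : ℝ) * (s + 1) - 1) / j| ≤ |t| * (√((k : ℝ) * (s + 1) - 1) / k) := by
    filter_upwards [eventually_ge_atTop 1] with k hk j hj
    have hkj : (k : ℝ) ≤ j := by exact_mod_cast (Finset.mem_Ico.1 hj).1
    rw [abs_div, abs_mul, Nat.abs_cast, abs_of_nonneg (Real.sqrt_nonneg _), mul_div_assoc]
    gcongr
  have hmean : Tendsto (fun k : ℕ => ∑ j ∈ Finset.Ico k (k * s), t * √((k : ℝ) * (s + 1) - 1) / j -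
      t * (√((k : ℝ) * (s + 1) - 1) * Real.log s)) atTop (𝓝 0) := by
    refine (mul_zero t ▸ (tendsto_sqrt_mul_harmonicDiff_sub_log hs).const_mul t).congr' ?_
    filter_upwards [eventually_ge_atTop 1] with k hk
    simp only [harmonicDiff_eq_sum hk hs, div_eq_mul_inv, ← Finset.mul_sum]
    ring
  have hvar : Tendsto (fun k : ℕ => ∑ j ∈ Finset.Ico k (k * s),
      (t * √((k : ℝ) * (s + 1) - 1) / j) ^ 2) atTop (𝓝 (t ^ 2 * (((s : ℝ) ^ 2 - 1) / s))) := by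
    refine ((tendsto_sampleSize_mul_sum_inv_sq hs).const_mul (t ^ 2)).congr' ?_
    filter_upwards [eventually_ge_atTop 1] with k hk
    simp only [div_eq_mul_inv, mul_pow, Real.sq_sqrt (sampleSize_nonneg hk s), inv_pow,
      ← Finset.mul_sum]
    ring
  convert tendsto_exp_mul_prod_one_sub_mul_I_inv hε hsmall hmean hvar using 3
  push_cast
  ring

lemma tendstoInDistribution_standardized_logRatio (hα : 0 < α) (hδ : 0 < δ) (hs : 1 ≤ s)
    (hlaw : ∀ k i, HasLaw (X k i) (paretoMeasure δ α) (P k))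
    (hindep : ∀ k, iIndepFun (X k) (P k)) :
    TendstoInDistribution
      (fun (k : ℕ) ω => √((k : ℝ) * (s + 1) - 1) *
        (α * logRatio k s (fun i => X k i ω) - Real.log s))
      atTop id P (gaussianReal 0 (((s : ℝ) ^ 2 - 1) / s).toNNReal) := by
  have hL (k : ℕ) : AEMeasurable (fun ω => logRatio k s (fun i => X k i ω)) (P k) := by fun_prop
  have hv : 0 ≤ ((s : ℝ) ^ 2 - 1) / s :=
    div_nonneg (sub_nonneg.2 (one_le_pow₀ (by exact_mod_cast hs))) s.cast_nonneg
  refine ⟨fun k => by have := hL k; fun_prop, aemeasurable_id, ?_⟩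
  refine ProbabilityMeasure.tendsto_iff_tendsto_charFun.2 fun t => ?_
  simp only [ProbabilityMeasure.coe_mk, Measure.map_id, charFun_gaussianReal,
    Real.coe_toNNReal _ hv]
  convert (tendsto_charFun_standardized_logRatio hs t).congr' ?_ using 2
  · push_cast
    ring_nf
  filter_upwards [eventually_ge_atTop 1] with k hk
  simp_rw [mul_sub, ← mul_assoc _ α]
  rw [charFun_map_const_mul_sub (hL k),
    charFun_map_logRatio hα hδ hs hk (hlaw k) (hindep k)]
  simp_rw [mul_right_comm _ α, mul_div_mul_right _ _ hα.ne', mul_comm _ t]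

end AsymptoticNormality

section Coverage

lemma tendsto_measureReal_of_tendstoInDistribution {ι E : Type*} {l : Filter ι}
    [TopologicalSpace E] [MeasurableSpace E] [OpensMeasurableSpace E] [HasOuterApproxClosed E]
    {Ω : ι → Type*} [∀ i, MeasurableSpace (Ω i)] {P : (i : ι) → Measure (Ω i)}
    [∀ i, IsProbabilityMeasure (P i)] {Y : (i : ι) → Ω i → E} {μ : Measure E}
    [IsProbabilityMeasure μ] (hY : TendstoInDistribution Y l id P μ) {A : Set E}
    (hA : MeasurableSet A) (hfrontier : μ (frontier A) = 0) :
    Tendsto (fun i => (P i).real {ω | Y i ω ∈ A}) l (𝓝 (μ.real A)) := by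
  have hlim := ProbabilityMeasure.tendsto_measure_of_null_frontier_of_tendsto' hY.tendsto
    (E := A) (by simpa using hfrontier)
  simp only [ProbabilityMeasure.coe_mk, Measure.map_id] at hlim
  refine ((ENNReal.tendsto_toReal (measure_ne_top μ A)).comp hlim).congr fun i => ?_
  exact map_measureReal_apply_of_aemeasurable (hY.forall_aemeasurable i) hA

-- For `L = 0` the left interval is `{0}`, as `x / 0 = 0`, and both sides are false.
lemma mem_Icc_div_sub_div_add_iff {α ℓ L c : ℝ} (hα : 0 < α) (hc : c < ℓ) (hL : 0 ≤ L) :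
    α ∈ Set.Icc ((ℓ - c) / L) ((ℓ + c) / L) ↔ α * L - ℓ ∈ Set.Icc (-c) c := by
  obtain rfl | hL := hL.eq_or_lt
  · simp only [div_zero, mul_zero, zero_sub, Set.mem_Icc, neg_le_neg_iff, hα.not_ge, and_false,
      hc.not_ge, false_and]
  · rw [Set.mem_Icc, Set.mem_Icc, div_le_iff₀ hL, le_div_iff₀ hL, neg_le_sub_iff_le_add,
      sub_le_iff_le_add, sub_le_iff_le_add']

lemma mem_confInterval_iff {α a : ℝ} {s k : ℕ} {x : Fin (k * (s + 1) - 1) → ℝ} (hα : 0 < α)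
    (hs : 2 ≤ s) (hk : 1 ≤ k) (hL : 0 ≤ logRatio k s x)
    (hlarge : normalQuantile (1 - a / 2) * √(((s : ℝ) ^ 2 - 1) / s) <
      √((k : ℝ) * (s + 1) - 1) * Real.log s) :
    α ∈ confInterval k s a x ↔
      (√(((s : ℝ) ^ 2 - 1) / s))⁻¹ *
          (√((k : ℝ) * (s + 1) - 1) * (α * logRatio k s x - Real.log s)) ∈
        Set.Icc (-normalQuantile (1 - a / 2)) (normalQuantile (1 - a / 2)) := by
  have hs' : (2 : ℝ) ≤ s := by exact_mod_cast hs
  have hk' : (1 : ℝ) ≤ k := by exact_mod_cast hk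
  have hn : 0 < (k : ℝ) * (s + 1) - 1 := by nlinarith
  have hσ : 0 < √(((s : ℝ) ^ 2 - 1) / s) := Real.sqrt_pos.2 (div_pos (by nlinarith) (by linarith))
  have hr : 0 < √((k : ℝ) * (s + 1) - 1) := Real.sqrt_pos.2 hn
  rw [confInterval, ← div_div, Real.sqrt_div' _ hn.le]
  set z := normalQuantile (1 - a / 2)
  set σ := √(((s : ℝ) ^ 2 - 1) / s)
  set r := √((k : ℝ) * (s + 1) - 1)
  set L := logRatio k s x
  have hc : z * (σ / r) < Real.log s := by
    rw [← mul_div_assoc, div_lt_iff₀' hr]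
    exact hlarge
  have hscale : σ⁻¹ * (r * (α * L - Real.log s)) = (α * L - Real.log s) / (σ / r) := by
    field_simp
  rw [div_mul_eq_mul_div, ← sub_div, ← add_div, mem_Icc_div_sub_div_add_iff hα hc hL, hscale,
    Set.mem_Icc, Set.mem_Icc, le_div_iff₀ (div_pos hσ hr), div_le_iff₀ (div_pos hσ hr), neg_mul]

variable {α δ : ℝ} {s : ℕ} {Ω : ℕ → Type*} [∀ k, MeasurableSpace (Ω k)]
  {P : (k : ℕ) → Measure (Ω k)} [∀ k, IsProbabilityMeasure (P k)]
  {X : (k : ℕ) → Fin (k * (s + 1) - 1) → Ω k → ℝ}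

lemma tendsto_measureReal_mem_confInterval (hα : 0 < α) (hδ : 0 < δ) (hs : 2 ≤ s)
    (hlaw : ∀ k i, HasLaw (X k i) (paretoMeasure δ α) (P k))
    (hindep : ∀ k, iIndepFun (X k) (P k)) {a : ℝ} (ha0 : 0 < a) (ha1 : a < 1) :
    Tendsto (fun k => (P k).real {ω | α ∈ confInterval k s a (fun i => X k i ω)})
      atTop (𝓝 (1 - a)) := by
  have hs' : (2 : ℝ) ≤ s := by exact_mod_cast hs
  have hv : 0 < ((s : ℝ) ^ 2 - 1) / s := div_pos (by nlinarith) (by linarith)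
  have hT := tendstoInDistribution_const_mul_gaussianReal
    (tendstoInDistribution_standardized_logRatio hα hδ (by omega) hlaw hindep)
    (√(((s : ℝ) ^ 2 - 1) / s))⁻¹
  rw [mul_zero, inv_pow, Real.sq_sqrt hv.le, inv_mul_cancel₀ hv.ne', Real.toNNReal_one] at hT
  set z := normalQuantile (1 - a / 2)
  have hlim := tendsto_measureReal_of_tendstoInDistribution hT
    (measurableSet_Icc (a := -z) (b := z))
    (gaussianReal_absolutelyContinuous 0 one_ne_zero
      ((convex_Icc (-z) z).addHaar_frontier volume))
  rw [gaussianReal_real_Icc_normalQuantile ha0 ha1] at hlim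
  refine hlim.congr' ?_
  have hlarge := ((tendsto_sqrt_sampleSize s).atTop_mul_const
    (Real.log_pos (by linarith : (1 : ℝ) < s))).eventually_gt_atTop (z * √(((s : ℝ) ^ 2 - 1) / s))
  filter_upwards [hlarge, eventually_ge_atTop 1] with k hlarge hk
  refine measureReal_congr ?_
  filter_upwards [ae_forall_pos_of_hasLaw_paretoMeasure hδ (hlaw k)] with ω hω
  exact propext (mem_confInterval_iff hα hs hk (logRatio_nonneg (by omega) hk hω) hlarge).symm

end Coverage

end ParetoOrder

open MeasureTheory ProbabilityTheory Filter Topology ParetoOrder in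
theorem theorem4 {α δ : ℝ} (hα : 0 < α) (hδ : 0 < δ) {s : ℕ} (hs : 2 ≤ s)
    {Ω : ℕ → Type*} [∀ k, MeasurableSpace (Ω k)]
    (P : (k : ℕ) → Measure (Ω k)) [∀ k, IsProbabilityMeasure (P k)]
    (X : (k : ℕ) → Fin (k * (s + 1) - 1) → Ω k → ℝ)
    (hlaw : ∀ k i, HasLaw (X k i) (paretoMeasure δ α) (P k))
    (hindep : ∀ k, iIndepFun (X k) (P k)) :
    TendstoInDistribution
      (fun (k : ℕ) ω => √((k : ℝ) * (s + 1) - 1) *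
        (logRatio k s (fun i => X k i ω) - 1 / α * Real.log s))
      atTop id P (gaussianReal 0 (((s : ℝ) ^ 2 - 1) / (s * α ^ 2)).toNNReal) ∧
    TendstoInDistribution
      (fun (k : ℕ) ω => √((k : ℝ) * (s + 1) - 1) * harmonicDiff k s *
        (α * Q k s (fun i => X k i ω) - Real.log s / harmonicDiff k s))
      atTop id P (gaussianReal 0 (((s : ℝ) ^ 2 - 1) / s).toNNReal) ∧
    TendstoInDistribution
      (fun (k : ℕ) ω => √((k : ℝ) * (s + 1) - 1) * (α * QStar k s (fun i => X k i ω) - 1))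
      atTop id P (gaussianReal 0 (((s : ℝ) ^ 2 - 1) / (s * Real.log s ^ 2)).toNNReal) ∧
    ∀ a : ℝ, 0 < a → a < 1 →
      Tendsto (fun k => (P k).real {ω | α ∈ confInterval k s a (fun i => X k i ω)})
        atTop (𝓝 (1 - a)) := by
  have hlog : 0 < Real.log s := Real.log_pos (by exact_mod_cast hs)
  have hT := tendstoInDistribution_standardized_logRatio hα hδ (by omega) hlaw hindep
  have hscaled (c : ℝ) := tendstoInDistribution_const_mul_gaussianReal hT c
  simp only [mul_zero] at hscaled
  refine ⟨?_, ?_, ?_, fun a => tendsto_measureReal_mem_confInterval hα hδ hs hlaw hindep⟩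
  · have hvar : α⁻¹ ^ 2 * (((s : ℝ) ^ 2 - 1) / s) = ((s : ℝ) ^ 2 - 1) / (s * α ^ 2) := by
      field_simp
    refine hvar ▸ (hscaled α⁻¹).congr (fun k => ae_of_all _ fun ω => ?_) ae_eq_rfl
    field_simp
  · refine hT.congr (fun k => ae_of_all _ fun ω => ?_) ae_eq_rfl
    obtain rfl | hk := k.eq_zero_or_pos
    · simp [Real.sqrt_eq_zero_of_nonpos]
    · have := harmonicDiff_pos hk hs
      simp only [Q]
      field_simp
  · have hvar : (Real.log s)⁻¹ ^ 2 * (((s : ℝ) ^ 2 - 1) / s) =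
        ((s : ℝ) ^ 2 - 1) / (s * Real.log s ^ 2) := by
      field_simp
    refine hvar ▸ (hscaled (Real.log s)⁻¹).congr (fun k => ae_of_all _ fun ω => ?_) ae_eq_rfl
    simp only [QStar]
    field_simp
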